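/- Let $\mathcal H=\mathbb C^{d_A}\otimes\mathbb C^{d_B}$ and let $\mathcal E=\{\eta_i,\rho_i\}_{i=0}^{1}$ be a two-state ensemble on $\mathcal H$: $\eta_0,\eta_1\ge 0$, $\eta_0+\eta_1=1$, and $\rho_0,\rho_1$ are density operators on $\mathcal H$. Write $\mathrm{PT}$ for the partial transposition and $|E|=\sqrt{E^\dagger E}$. For a two-state ensemble $\mathcal E$ on a bipartite space define $$q_G(\mathcal E)=\max_{\{M_0,M_1\}}\sum_{i=0}^{1}\eta_i\operatorname{Tr}(\rho_i^{\mathrm{PT}}M_i),\qquad p_L(\mathcal E)=\sup_{\{M_0,M_1\}\ \mathrm{LOCC}}\sum_{i=0}^{1}\eta_i\operatorname{Tr}(\rho_iM_i),$$ where the maximum is over all measurements ($M_i\succeq 0$, $M_0+M_1=\mathbb 1$) and the supremum over those that a finite protocol of local operations and classical communication (LOCC) between the two parties realizes. For a positive integer $L$ let $\mathcal E^{(L)}=\{\eta_i^{(L)},\rho_i^{(L)}\}_{i=0}^1$ be the ensemble on $(\mathbb C^{d_A})^{\otimes L}\otimes(\mathbb C^{d_B})^{\otimes L}$ (Alice holds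 the first factor, Bob the second) with $$\eta_i^{(L)}=\sum_{c}\prod_{l=1}^L\eta_{c_l},\qquad \rho_i^{(L)}=\frac1{\eta_i^{(L)}}\sum_{c}\Big(\prod_{l=1}^L\eta_{c_l}\Big)\bigotimes_{l=1}^L\rho_{c_l},$$ both sums being over all $c\in\{0,1\}^L$ with $c_1+\dots+c_L\equiv i\pmod 2$ (if $\eta_i^{(L)}=0$, the state $\rho_i^{(L)}$ is immaterial and may be any density operator). Then the maxima defining $q_G(\mathcal E)$ and $q_G(\mathcal E^{(L)})$ exist, and for every positive integer $L$ $$q_G(\mathcal E^{(L)})=\tfrac12+\tfrac12\big(\operatorname{Tr}|\eta_0\rho_0^{\mathrm{PT}}-\eta_1\rho_1^{\mathrm{PT}}|\big)^L=\tfrac12+\tfrac12\big[2q_G(\mathcal E)-1\big]^L .$$ Moreover, if $p_L(\mathcal E)=q_G(\mathcal E)$, then $p_L(\mathcal E^{(L)})=q_G(\mathcal E^{(L)})$; and if some LOCC measurement attains the value $q_G(\mathcal E)$ as the maximal LOCC success probability for $\mathcal E$, then some LOCC measurement attains the value $q_G(\mathcal E^{(L)})$ as the maximal LOCC success probability for $\mathcal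 E^{(L)}$. -/

import Mathlib

open Matrix
open scoped ComplexOrder MatrixOrder Kronecker

universe u v

/-- A bipartite quantum state ensemble of `n` states: the state `ρ i` (a positive semidefinite
operator of unit trace on the bipartite space `ℂ^A ⊗ ℂ^B`, written as a matrix indexed by `A × B`)
is prepared with probability `η i`. -/
structure BipartiteEnsemble (A : Type u) (B : Type v) [Fintype A] [Fintype B] (n : ℕ) where
  /-- the prior probabilities -/
  η : Fin n → ℝ
  /-- the states -/
  ρ : Fin n → Matrix (A × B) (A × B) ℂ
  η_nonneg : ∀ i, 0 ≤ η i
  η_sum : ∑ i, η i = 1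
  ρ_posSemidef : ∀ i, (ρ i).PosSemidef
  ρ_trace : ∀ i, (ρ i).trace = 1

/-- A measurement (POVM) with `n` outcomes. -/
def IsMeasurement {H : Type*} [Fintype H] [DecidableEq H] {n : ℕ}
    (M : Fin n → Matrix H H ℂ) : Prop :=
  (∀ i, (M i).PosSemidef) ∧ ∑ i, M i = 1

/-- `M` is realized by a finite protocol of local operations and classical communication between
Alice (holding `A`) and Bob (holding `B`). Either the protocol stops and announces an outcome `i₀`,
or one of the two parties performs a local quantum operation with Kraus operators `K x` (into a
space of any finite dimension), announces the result `x` to the other party, and they go on with a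
protocol that may depend on `x` and realizes the measurement `N x` on the new systems. -/
inductive IsLOCC {n : ℕ} : ∀ {A : Type u} {B : Type v} [Fintype A] [Fintype B]
    [DecidableEq A] [DecidableEq B], (Fin n → Matrix (A × B) (A × B) ℂ) → Prop
  | announce {A : Type u} {B : Type v} [Fintype A] [Fintype B] [DecidableEq A] [DecidableEq B]
      (i₀ : Fin n) :
      IsLOCC (fun i => if i = i₀ then (1 : Matrix (A × B) (A × B) ℂ) else 0)
  | alice {A A' : Type u} {B : Type v} [Fintype A] [Fintype A'] [Fintype B]
      [DecidableEq A] [DecidableEq A'] [DecidableEq B] (k : ℕ)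
      (K : Fin k → Matrix A' A ℂ) (hK : ∑ x, (K x)ᴴ * K x = 1)
      (N : Fin k → Fin n → Matrix (A' × B) (A' × B) ℂ) (hN : ∀ x, IsLOCC (N x)) :
      IsLOCC (fun i => ∑ x,
        (K x ⊗ₖ (1 : Matrix B B ℂ))ᴴ * N x i * (K x ⊗ₖ (1 : Matrix B B ℂ)))
  | bob {A : Type u} {B B' : Type v} [Fintype A] [Fintype B] [Fintype B']
      [DecidableEq A] [DecidableEq B] [DecidableEq B'] (k : ℕ)
      (K : Fin k → Matrix B' B ℂ) (hK : ∑ x, (K x)ᴴ * K x = 1)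
      (N : Fin k → Fin n → Matrix (A × B') (A × B') ℂ) (hN : ∀ x, IsLOCC (N x)) :
      IsLOCC (fun i => ∑ x,
        ((1 : Matrix A A ℂ) ⊗ₖ K x)ᴴ * N x i * ((1 : Matrix A A ℂ) ⊗ₖ K x))

/-- Partial transposition (on the second subsystem). -/
def partialTranspose {A : Type u} {B : Type v} (M : Matrix (A × B) (A × B) ℂ) :
    Matrix (A × B) (A × B) ℂ :=
  Matrix.of fun x y => M (x.1, y.2) (y.1, x.2)

/-- `Tr |E|`, where `|E| = √(E† E)`. -/
noncomputable def traceAbs {H : Type*} [Fintype H] [DecidableEq H] (E : Matrix H H ℂ) : ℝ :=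
  (CFC.sqrt (Eᴴ * E)).trace.re

/-- The tensor product of `L` operators on `ℂ^A ⊗ ℂ^B`, as an operator on the bipartite space in
which Alice holds the `L` copies of `A` and Bob the `L` copies of `B`. -/
def bipartiteTensor {A : Type u} {B : Type v} {L : ℕ} (M : Fin L → Matrix (A × B) (A × B) ℂ) :
    Matrix ((Fin L → A) × (Fin L → B)) ((Fin L → A) × (Fin L → B)) ℂ :=
  Matrix.of fun x y => ∏ l, M l (x.1 l, x.2 l) (y.1 l, y.2 l)

theorem bipartiteTensor_posSemidef {A : Type u} {B : Type v} [Fintype A] [Fintype B] {L : ℕ}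
    (M : Fin L → Matrix (A × B) (A × B) ℂ) (hM : ∀ l, (M l).PosSemidef) :
    (bipartiteTensor M).PosSemidef := by
  have key : ∀ s : Finset (Fin L), (Matrix.of fun (x y : (Fin L → A) × (Fin L → B)) =>
      ∏ l ∈ s, M l (x.1 l, x.2 l) (y.1 l, y.2 l)).PosSemidef := by
    intro s
    induction s using Finset.induction_on with
    | empty =>
      have h := Matrix.posSemidef_vecMulVec_self_star
        (fun _ : (Fin L → A) × (Fin L → B) => (1 : ℂ))
      convert h using 1
      ext x y
      simp [Matrix.vecMulVec_apply]
    | insert a s ha ih =>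
      have h := ((hM a).submatrix
        (fun x : (Fin L → A) × (Fin L → B) => (x.1 a, x.2 a))).hadamard ih
      have heq : (Matrix.of fun (x y : (Fin L → A) × (Fin L → B)) =>
          ∏ l ∈ insert a s, M l (x.1 l, x.2 l) (y.1 l, y.2 l)) =
          ((M a).submatrix (fun x : (Fin L → A) × (Fin L → B) => (x.1 a, x.2 a))
            (fun x => (x.1 a, x.2 a))) ⊙
          Matrix.of fun (x y : (Fin L → A) × (Fin L → B)) =>
            ∏ l ∈ s, M l (x.1 l, x.2 l) (y.1 l, y.2 l) := by
        ext x y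
        simp [Finset.prod_insert ha, Matrix.hadamard_apply]
      rw [heq]
      exact h
  exact key Finset.univ

theorem bipartiteTensor_trace {A : Type u} {B : Type v} [Fintype A] [Fintype B] {L : ℕ}
    (M : Fin L → Matrix (A × B) (A × B) ℂ) :
    (bipartiteTensor M).trace = ∏ l, (M l).trace := by
  classical
  simp only [Matrix.trace, Matrix.diag, bipartiteTensor, Matrix.of_apply]
  rw [Fintype.prod_sum]
  symm
  exact Fintype.sum_equiv (Equiv.arrowProdEquivProdArrow (Fin L) (fun _ => A) (fun _ => B)) _ _
    (fun _ => rfl)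

/-- The sum of the entries of `c`, modulo `n`. -/
def modSum {n L : ℕ} (c : Fin L → Fin n) : ℕ := (∑ l, (c l : ℕ)) % n

namespace BipartiteEnsemble

variable {A : Type u} {B : Type v} [Fintype A] [Fintype B] {n : ℕ}

/-- The probability of the string `c` in the `L`-fold ensemble. -/
def foldProb (E : BipartiteEnsemble A B n) {L : ℕ} (c : Fin L → Fin n) : ℝ :=
  ∏ l, E.η (c l)

/-- The state with index `c` in the `L`-fold ensemble. -/
def foldState (E : BipartiteEnsemble A B n) {L : ℕ} (c : Fin L → Fin n) :
    Matrix ((Fin L → A) × (Fin L → B)) ((Fin L → A) × (Fin L → B)) ℂ :=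
  bipartiteTensor fun l => E.ρ (c l)

/-- The probability that the modulo `n` sum of the string is `i`. -/
def multiProb (E : BipartiteEnsemble A B n) (L : ℕ) (i : Fin n) : ℝ :=
  ∑ c : Fin L → Fin n with modSum c = i, E.foldProb c

/-- The average state of the strings whose modulo `n` sum is `i`. If this event has probability `0`
the state is immaterial; it is then taken to be a product of copies of `ρ i`. -/
noncomputable def multiState (E : BipartiteEnsemble A B n) (L : ℕ) (i : Fin n) :
    Matrix ((Fin L → A) × (Fin L → B)) ((Fin L → A) × (Fin L → B)) ℂ :=
  if E.multiProb L i = 0 then bipartiteTensor fun _ => E.ρ i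
  else (E.multiProb L i)⁻¹ • ∑ c : Fin L → Fin n with modSum c = i, E.foldProb c • E.foldState c

theorem foldProb_nonneg (E : BipartiteEnsemble A B n) {L : ℕ} (c : Fin L → Fin n) :
    0 ≤ E.foldProb c :=
  Finset.prod_nonneg fun _ _ => E.η_nonneg _

theorem multiProb_nonneg (E : BipartiteEnsemble A B n) (L : ℕ) (i : Fin n) :
    0 ≤ E.multiProb L i :=
  Finset.sum_nonneg fun _ _ => E.foldProb_nonneg _

theorem multiProb_sum (E : BipartiteEnsemble A B n) (L : ℕ) : ∑ i, E.multiProb L i = 1 := by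
  classical
  have hn : 0 < n := by
    rcases Nat.eq_zero_or_pos n with h | h
    · subst h
      have := E.η_sum
      simp at this
    · exact h
  have h1 : ∑ i, E.multiProb L i = ∑ c : Fin L → Fin n, E.foldProb c := by
    have := Finset.sum_fiberwise (Finset.univ : Finset (Fin L → Fin n))
      (fun c => (⟨modSum c, Nat.mod_lt _ hn⟩ : Fin n)) E.foldProb
    rw [← this]
    refine Finset.sum_congr rfl fun i _ => ?_
    simp only [multiProb, Fin.ext_iff]
  rw [h1]
  simp only [foldProb]
  rw [← Fintype.prod_sum (fun (_ : Fin L) (j : Fin n) => E.η j)]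
  simp [E.η_sum]

theorem multiState_posSemidef (E : BipartiteEnsemble A B n) (L : ℕ) (i : Fin n) :
    (E.multiState L i).PosSemidef := by
  unfold multiState
  split_ifs with h
  · exact bipartiteTensor_posSemidef _ fun _ => E.ρ_posSemidef i
  · refine Matrix.PosSemidef.smul ?_ (inv_nonneg.2 (E.multiProb_nonneg L i))
    refine Matrix.posSemidef_sum _ fun c _ => ?_
    exact Matrix.PosSemidef.smul (bipartiteTensor_posSemidef _ fun _ => E.ρ_posSemidef _)
      (E.foldProb_nonneg c)

theorem multiState_trace (E : BipartiteEnsemble A B n) (L : ℕ) (i : Fin n) :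
    (E.multiState L i).trace = 1 := by
  unfold multiState
  split_ifs with h
  · simp [bipartiteTensor_trace, E.ρ_trace]
  · simp only [Matrix.trace_smul, Matrix.trace_sum, foldState, bipartiteTensor_trace, E.ρ_trace,
      Finset.prod_const_one]
    rw [← Finset.sum_smul, smul_smul]
    change ((E.multiProb L i)⁻¹ * E.multiProb L i) • (1 : ℂ) = 1
    rw [inv_mul_cancel₀ h, one_smul]

/-- The ensemble `ℰ^(L)` of the problem of guessing the modulo `n` sum of the string `c` from the
state with index `c` of the `L`-fold ensemble. -/
noncomputable def multifold (E : BipartiteEnsemble A B n) (L : ℕ) :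
    BipartiteEnsemble (Fin L → A) (Fin L → B) n where
  η := E.multiProb L
  ρ := E.multiState L
  η_nonneg := E.multiProb_nonneg L
  η_sum := E.multiProb_sum L
  ρ_posSemidef := E.multiState_posSemidef L
  ρ_trace := E.multiState_trace L

/-- The average probability of a correct guess with the measurement `M`. -/
noncomputable def successProb (E : BipartiteEnsemble A B n)
    (M : Fin n → Matrix (A × B) (A × B) ℂ) : ℝ :=
  ∑ i, E.η i * (E.ρ i * M i).trace.re

/-- The quantity corresponding to `successProb` for the partially transposed states. -/
noncomputable def ptSuccess (E : BipartiteEnsemble A B n)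
    (M : Fin n → Matrix (A × B) (A × B) ℂ) : ℝ :=
  ∑ i, E.η i * (partialTranspose (E.ρ i) * M i).trace.re

/-- The success probabilities of the LOCC measurements. -/
def loccValues [DecidableEq A] [DecidableEq B] (E : BipartiteEnsemble A B n) : Set ℝ :=
  {p | ∃ M : Fin n → Matrix (A × B) (A × B) ℂ, IsLOCC M ∧ E.successProb M = p}

/-- The values of `ptSuccess` on all measurements. -/
def ptValues [DecidableEq A] [DecidableEq B] (E : BipartiteEnsemble A B n) : Set ℝ :=
  {p | ∃ M : Fin n → Matrix (A × B) (A × B) ℂ, IsMeasurement M ∧ E.ptSuccess M = p}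

/-- The optimal success probability `p_L` of LOCC measurements. -/
noncomputable def pL [DecidableEq A] [DecidableEq B] (E : BipartiteEnsemble A B n) : ℝ :=
  sSup E.loccValues

/-- The optimal distinguishability `q_G` of the partially transposed states. -/
noncomputable def qG [DecidableEq A] [DecidableEq B] (E : BipartiteEnsemble A B n) : ℝ :=
  sSup E.ptValues

end BipartiteEnsemble

/-! ### Helstrom bound for Hermitian matrices -/

section Helstrom

variable {H : Type*} [Fintype H] [DecidableEq H]

/-! Everything is governed by Λ = η₀ρ₀ − η₁ρ₁ (`gap`): a binary measurement succeeds with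
probability 1/2 + 1/2 Tr Λ(M₀ − M₁), so by Helstrom's argument q_G = 1/2 + 1/2 Tr|Λ^PT| (`qG_eq`).

Expanding Λ^{⊗L} gives each string c the sign (−1)^{Σ c_l}, so the parity ensemble has gap exactly
Λ^{⊗L} (`gap_multifold`). Partial transposition, absolute value and trace all respect tensor powers,
whence the formula for q_G of the parity ensemble.

On the LOCC side, measuring each copy separately and announcing the parity of the results has
difference operator (M₀ − M₁)^{⊗L} (`IsLOCC.exists_parity`), so an LOCC value p yields the LOCC
value 1/2 + 1/2 (2p − 1)^L. Conversely q_G bounds all LOCC values, because the partial transpose of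
an LOCC measurement is again a measurement and Tr(XY) = Tr(X^PT Y^PT). Both inheritance claims
follow, the one about suprema by continuity. -/

theorem Matrix.PosSemidef.trace_mul_re_nonneg {S T : Matrix H H ℂ} (hS : S.PosSemidef)
    (hT : T.PosSemidef) : 0 ≤ (S * T).trace.re := by
  have h0 : (0 : Matrix H H ℂ) ≤ S := nonneg_iff_posSemidef.2 hS
  have hs : (CFC.sqrt S).PosSemidef := nonneg_iff_posSemidef.1 (CFC.sqrt_nonneg S)
  have h1 : (S * T).trace = ((CFC.sqrt S)ᴴ * T * CFC.sqrt S).trace := by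
    rw [hs.isHermitian.eq]
    conv_lhs => rw [← CFC.sqrt_mul_sqrt_self S h0]
    rw [Matrix.mul_assoc, Matrix.trace_mul_comm]
  rw [h1]
  exact (Complex.le_def.1 (hT.conjTranspose_mul_mul_same _).trace_nonneg).1

omit [DecidableEq H] in
theorem Matrix.IsHermitian.trace_mul_im_eq_zero {S T : Matrix H H ℂ} (hS : S.IsHermitian)
    (hT : T.IsHermitian) : (S * T).trace.im = 0 := by
  rw [← Complex.conj_eq_iff_im, starRingEnd_apply, ← Matrix.trace_conjTranspose,
    Matrix.conjTranspose_mul, hS.eq, hT.eq, Matrix.trace_mul_comm]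

/-- The success probability of a binary measurement, in terms of the difference operator. -/
theorem binary_success_eq {S T M N : Matrix H H ℂ} (hST : S.trace + T.trace = 1)
    (hMN : M + N = 1) :
    (S * M).trace.re + (T * N).trace.re = 1 / 2 + 1 / 2 * ((S - T) * (M - N)).trace.re := by
  have h : (S * M).trace + (S * N).trace + ((T * M).trace + (T * N).trace) = 1 := by
    rw [← Matrix.trace_add, ← Matrix.trace_add, ← Matrix.mul_add, ← Matrix.mul_add, hMN,
      Matrix.mul_one, Matrix.mul_one, hST]
  have h' := congrArg Complex.re h
  simp only [Complex.add_re, Complex.one_re] at h'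
  simp only [Matrix.sub_mul, Matrix.mul_sub, Matrix.trace_sub, Complex.sub_re]
  linarith

theorem traceAbs_eq_posPart_add_negPart {S : Matrix H H ℂ} (hS : S.IsHermitian) :
    traceAbs S = (S⁺).trace.re + (S⁻).trace.re := by
  have h := CFC.posPart_add_negPart S hS.isSelfAdjoint
  rw [← Complex.add_re, ← Matrix.trace_add, h]
  -- `CFC.abs S` unfolds to the square root in `traceAbs`.
  rfl

/-- With S = S⁺ − S⁻ and M + N = 1, the right side exceeds the left by 2 Tr(S⁺N) + 2 Tr(S⁻M), which
is nonnegative. -/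
theorem trace_mul_sub_le_traceAbs {S M N : Matrix H H ℂ} (hS : S.IsHermitian)
    (hM : M.PosSemidef) (hN : N.PosSemidef) (hMN : M + N = 1) :
    (S * (M - N)).trace.re ≤ traceAbs S := by
  have hp : (S⁺).PosSemidef := nonneg_iff_posSemidef.1 (CFC.posPart_nonneg S)
  have hn : (S⁻).PosSemidef := nonneg_iff_posSemidef.1 (CFC.negPart_nonneg S)
  have h1 := hp.trace_mul_re_nonneg hN
  have h2 := hn.trace_mul_re_nonneg hM
  have e1 : (S⁺).trace.re = (S⁺ * M).trace.re + (S⁺ * N).trace.re := by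
    rw [← Complex.add_re, ← Matrix.trace_add, ← Matrix.mul_add, hMN, Matrix.mul_one]
  have e2 : (S⁻).trace.re = (S⁻ * M).trace.re + (S⁻ * N).trace.re := by
    rw [← Complex.add_re, ← Matrix.trace_add, ← Matrix.mul_add, hMN, Matrix.mul_one]
  have e3 : (S * (M - N)).trace.re = ((S⁺ - S⁻) * (M - N)).trace.re := by
    rw [CFC.posPart_sub_negPart S hS.isSelfAdjoint]
  rw [traceAbs_eq_posPart_add_negPart hS, e3]
  simp only [Matrix.sub_mul, Matrix.mul_sub, Matrix.trace_sub, Complex.sub_re]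
  linarith

/-- The spectral projections of S onto [0, ∞) and (−∞, 0) are optimal: their difference is a sign of
S, and x · sign x = |x|. -/
theorem exists_trace_mul_sub_eq_traceAbs {S : Matrix H H ℂ} (hS : S.IsHermitian) :
    ∃ M N : Matrix H H ℂ, M.PosSemidef ∧ N.PosSemidef ∧ M + N = 1 ∧
      (S * (M - N)).trace.re = traceAbs S := by
  have hsa : IsSelfAdjoint S := hS.isSelfAdjoint
  -- A finite spectrum makes even the indicator functions below admissible in the continuous
  -- functional calculus.
  have hc : ∀ f : ℝ → ℝ, ContinuousOn f (spectrum ℝ S) := fun f =>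
    (Matrix.finite_real_spectrum (A := S)).continuousOn f
  let f : ℝ → ℝ := fun x => if 0 ≤ x then 1 else 0
  let g : ℝ → ℝ := fun x => if 0 ≤ x then 0 else 1
  refine ⟨cfc f S, cfc g S, nonneg_iff_posSemidef.1 (cfc_nonneg fun x _ => ?_),
    nonneg_iff_posSemidef.1 (cfc_nonneg fun x _ => ?_), ?_, ?_⟩
  · simp only [f]; split_ifs <;> norm_num
  · simp only [g]; split_ifs <;> norm_num
  · rw [← cfc_add (hf := hc _) (hg := hc _), ← cfc_one ℝ S]
    refine cfc_congr fun x _ => ?_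
    simp only [f, g, Pi.one_apply]; split_ifs <;> norm_num
  · have h : S * (cfc f S - cfc g S) = CFC.abs S := by
      rw [← cfc_sub (hf := hc _) (hg := hc _), CFC.abs_eq_cfc_norm S hsa]
      nth_rewrite 1 [← cfc_id ℝ S]
      rw [← cfc_mul (hf := hc _) (hg := hc _)]
      refine cfc_congr fun x _ => ?_
      simp only [f, g, id, Real.norm_eq_abs]
      split_ifs with hx
      · simp [abs_of_nonneg hx]
      · simp [abs_of_neg (not_le.1 hx)]
    rw [h]
    rfl

end Helstrom

/-! ### Tensor powers -/

section Tensor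

variable {A : Type u} {B : Type v} {L : ℕ}

theorem bipartiteTensor_mul [Fintype A] [Fintype B] (M N : Fin L → Matrix (A × B) (A × B) ℂ) :
    bipartiteTensor M * bipartiteTensor N = bipartiteTensor fun l => M l * N l := by
  classical
  ext x y
  simp only [Matrix.mul_apply, bipartiteTensor, Matrix.of_apply, ← Finset.prod_mul_distrib]
  rw [Fintype.prod_sum]
  symm
  exact Fintype.sum_equiv (Equiv.arrowProdEquivProdArrow (Fin L) (fun _ => A) (fun _ => B)) _ _
    (fun _ => rfl)

theorem bipartiteTensor_conjTranspose (M : Fin L → Matrix (A × B) (A × B) ℂ) :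
    (bipartiteTensor M)ᴴ = bipartiteTensor fun l => (M l)ᴴ := by
  ext x y
  simp [bipartiteTensor]

theorem bipartiteTensor_partialTranspose (M : Fin L → Matrix (A × B) (A × B) ℂ) :
    partialTranspose (bipartiteTensor M) = bipartiteTensor fun l => partialTranspose (M l) :=
  rfl

/-- |S|^{⊗L} is positive and squares to (S^{⊗L})†S^{⊗L}, so it is |S^{⊗L}| by uniqueness of the
square root. -/
theorem traceAbs_bipartiteTensor [Fintype A] [Fintype B] [DecidableEq A] [DecidableEq B]
    (S : Matrix (A × B) (A × B) ℂ) :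
    traceAbs (bipartiteTensor fun _ : Fin L => S) = traceAbs S ^ L := by
  have h0 : (0 : Matrix (A × B) (A × B) ℂ) ≤ Sᴴ * S :=
    nonneg_iff_posSemidef.2 (Matrix.posSemidef_conjTranspose_mul_self S)
  have hs : (CFC.sqrt (Sᴴ * S)).PosSemidef := nonneg_iff_posSemidef.1 (CFC.sqrt_nonneg _)
  have h : CFC.sqrt ((bipartiteTensor fun _ : Fin L => S)ᴴ * bipartiteTensor fun _ => S) =
      bipartiteTensor fun _ => CFC.sqrt (Sᴴ * S) := by
    refine CFC.sqrt_unique ?_ (nonneg_iff_posSemidef.2 (bipartiteTensor_posSemidef _ fun _ => hs))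
    rw [bipartiteTensor_mul, bipartiteTensor_conjTranspose, bipartiteTensor_mul,
      CFC.sqrt_mul_sqrt_self _ h0]
  -- The trace is real, so taking the real part commutes with the L-th power.
  have him : (CFC.sqrt (Sᴴ * S)).trace = ((CFC.sqrt (Sᴴ * S)).trace.re : ℂ) :=
    Complex.ext rfl (by simpa using (Complex.le_def.1 hs.trace_nonneg).2.symm)
  unfold traceAbs
  rw [h, bipartiteTensor_trace, Finset.prod_const, Finset.card_univ, Fintype.card_fin, him,
    ← Complex.ofReal_pow, Complex.ofReal_re, Complex.ofReal_re]

end Tensor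

/-! ### Partial transposition -/

section PartialTranspose

variable {A A' : Type u} {B B' : Type v}

theorem partialTranspose_sub (M N : Matrix (A × B) (A × B) ℂ) :
    partialTranspose (M - N) = partialTranspose M - partialTranspose N :=
  rfl

theorem partialTranspose_smul (r : ℝ) (M : Matrix (A × B) (A × B) ℂ) :
    partialTranspose (r • M) = r • partialTranspose M :=
  rfl

theorem partialTranspose_sum {ι : Type*} (s : Finset ι) (M : ι → Matrix (A × B) (A × B) ℂ) :
    partialTranspose (∑ x ∈ s, M x) = ∑ x ∈ s, partialTranspose (M x) := by
  ext x y
  simp [partialTranspose, Matrix.sum_apply]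

theorem partialTranspose_zero : partialTranspose (0 : Matrix (A × B) (A × B) ℂ) = 0 :=
  rfl

theorem partialTranspose_one [DecidableEq A] [DecidableEq B] :
    partialTranspose (1 : Matrix (A × B) (A × B) ℂ) = 1 := by
  ext x y
  simp only [partialTranspose, Matrix.of_apply, Matrix.one_apply, Prod.ext_iff]
  congr 1
  exact propext ⟨fun h => ⟨h.1, h.2.symm⟩, fun h => ⟨h.1, h.2.symm⟩⟩

theorem isHermitian_partialTranspose {M : Matrix (A × B) (A × B) ℂ} (hM : M.IsHermitian) :
    (partialTranspose M).IsHermitian := by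
  ext x y
  exact hM.apply _ _

/-- Transposing Bob's indices in both factors only interchanges the names of two summation indices.
-/
theorem partialTranspose_trace_mul [Fintype A] [Fintype B] (M N : Matrix (A × B) (A × B) ℂ) :
    (partialTranspose M * partialTranspose N).trace = (M * N).trace := by
  simp only [Matrix.trace, Matrix.diag, Matrix.mul_apply, partialTranspose, Matrix.of_apply,
    Fintype.sum_prod_type]
  refine Finset.sum_congr rfl fun a _ => ?_
  rw [Finset.sum_comm]
  conv_rhs => rw [Finset.sum_comm]
  refine Finset.sum_congr rfl fun a' _ => ?_
  rw [Finset.sum_comm]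

/-- Bob's two operators trade sides as transposes, which amounts to replacing J by its entrywise
conjugate. Thus partial transposition carries a local operation to a local operation. -/
theorem partialTranspose_kronecker_conj [Fintype A] [Fintype B] (K : Matrix A A' ℂ)
    (J : Matrix B B' ℂ) (N : Matrix (A × B) (A × B) ℂ) :
    partialTranspose ((K ⊗ₖ J)ᴴ * N * (K ⊗ₖ J)) =
      (K ⊗ₖ J.map star)ᴴ * partialTranspose N * (K ⊗ₖ J.map star) := by
  ext x y
  simp only [partialTranspose, Matrix.of_apply, Matrix.mul_apply, Matrix.conjTranspose_apply,
    Matrix.kroneckerMap_apply, Matrix.map_apply, Fintype.sum_prod_type, Finset.sum_mul, star_mul',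
    star_star]
  refine Finset.sum_congr rfl fun a _ => ?_
  rw [Finset.sum_comm]
  conv_rhs => rw [Finset.sum_comm]
  refine Finset.sum_congr rfl fun a' _ => ?_
  rw [Finset.sum_comm]
  refine Finset.sum_congr rfl fun b _ => Finset.sum_congr rfl fun b' _ => ?_
  ring

end PartialTranspose

/-! ### LOCC measurements -/

section LOCC

theorem sum_map_star_conjTranspose_mul {B B' : Type*} [Fintype B'] [DecidableEq B] {k : ℕ}
    {K : Fin k → Matrix B' B ℂ} (hK : ∑ x, (K x)ᴴ * K x = 1) :
    ∑ x, ((K x).map star)ᴴ * (K x).map star = 1 := by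
  have h := congrArg (fun M => M.map (starRingEnd ℂ)) hK
  simp only [Matrix.map_one _ (map_zero (starRingEnd ℂ)) (map_one (starRingEnd ℂ))] at h
  rw [← h]
  ext a b
  simp [Matrix.sum_apply, Matrix.mul_apply]

theorem isMeasurement_sum_conj {H H' : Type*} [Fintype H] [Fintype H'] [DecidableEq H]
    [DecidableEq H'] {n k : ℕ} {X : Fin k → Matrix H' H ℂ} (hX : ∑ x, (X x)ᴴ * X x = 1)
    {N : Fin k → Fin n → Matrix H' H' ℂ} (hN : ∀ x, IsMeasurement (N x)) :
    IsMeasurement fun i => ∑ x, (X x)ᴴ * N x i * X x := by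
  refine ⟨fun i => Matrix.posSemidef_sum _ fun x _ => ((hN x).1 i).conjTranspose_mul_mul_same _, ?_⟩
  rw [Finset.sum_comm, ← hX]
  refine Finset.sum_congr rfl fun x _ => ?_
  rw [← Matrix.sum_mul, ← Matrix.mul_sum, (hN x).2, Matrix.mul_one]

theorem sum_kronecker_one_conj {A A' B : Type*} [Fintype A'] [Fintype B] [DecidableEq A]
    [DecidableEq B] {k : ℕ} {K : Fin k → Matrix A' A ℂ} (hK : ∑ x, (K x)ᴴ * K x = 1) :
    ∑ x, (K x ⊗ₖ (1 : Matrix B B ℂ))ᴴ * (K x ⊗ₖ (1 : Matrix B B ℂ)) = 1 := by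
  simp only [Matrix.conjTranspose_kronecker, ← Matrix.mul_kronecker_mul,
    Matrix.conjTranspose_one, Matrix.mul_one]
  rw [← Matrix.one_kronecker_one, ← hK]
  ext x y
  simp [Matrix.sum_apply, Finset.sum_mul]

theorem sum_one_kronecker_conj {A B B' : Type*} [Fintype A] [Fintype B'] [DecidableEq A]
    [DecidableEq B] {k : ℕ} {K : Fin k → Matrix B' B ℂ} (hK : ∑ x, (K x)ᴴ * K x = 1) :
    ∑ x, ((1 : Matrix A A ℂ) ⊗ₖ K x)ᴴ * ((1 : Matrix A A ℂ) ⊗ₖ K x) = 1 := by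
  simp only [Matrix.conjTranspose_kronecker, ← Matrix.mul_kronecker_mul,
    Matrix.conjTranspose_one, Matrix.mul_one]
  rw [← Matrix.one_kronecker_one, ← hK]
  ext x y
  simp [Matrix.sum_apply, Finset.mul_sum]

variable {A A' C : Type u} {B B' D : Type v} [Fintype A] [Fintype A'] [Fintype B] [Fintype B']
  [Fintype C] [Fintype D] [DecidableEq A] [DecidableEq A'] [DecidableEq B] [DecidableEq B']
  [DecidableEq C] [DecidableEq D] {n : ℕ}

/-- LOCC measurements have positive partial transposes. -/
theorem IsLOCC.isMeasurement_partialTranspose {M : Fin n → Matrix (A × B) (A × B) ℂ}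
    (hM : IsLOCC M) : IsMeasurement fun i => partialTranspose (M i) := by
  induction hM with
  | announce i₀ =>
    constructor
    · intro i
      dsimp only
      split_ifs
      · rw [partialTranspose_one]
        exact Matrix.PosSemidef.one
      · rw [partialTranspose_zero]
        exact Matrix.PosSemidef.zero
    · rw [← partialTranspose_sum]
      simp [partialTranspose_one]
  | alice k K hK N _ ih =>
    -- Bob's factor is the identity, which is its own entrywise conjugate, so Alice's Kraus
    -- operators stay as they are.
    simp only [partialTranspose_sum, partialTranspose_kronecker_conj,
      Matrix.map_one star (star_zero ℂ) (star_one ℂ)]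
    exact isMeasurement_sum_conj (sum_kronecker_one_conj hK) ih
  | bob k K hK N _ ih =>
    simp only [partialTranspose_sum, partialTranspose_kronecker_conj]
    exact isMeasurement_sum_conj (sum_one_kronecker_conj (sum_map_star_conjTranspose_mul hK)) ih

/-- Relabelling the outcomes. -/
theorem IsLOCC.perm {M : Fin n → Matrix (A × B) (A × B) ℂ} (hM : IsLOCC M)
    (σ : Equiv.Perm (Fin n)) : IsLOCC fun i => M (σ i) := by
  induction hM with
  | announce i₀ =>
    have h : ∀ i, (σ i = i₀) = (i = σ.symm i₀) := fun i => propext (Equiv.eq_symm_apply σ).symm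
    simp only [h]
    exact .announce _
  | alice k K hK N _ ih => exact .alice k K hK (fun x i => N x (σ i)) ih
  | bob k K hK N _ ih => exact .bob k K hK (fun x i => N x (σ i)) ih

/-- Each column of X is either zero or a single basis vector, so the conjugation merely selects
entries of N. This evaluates the Kraus operators that discard a subsystem. -/
theorem conjTranspose_partialPerm_mul_mul {P Q : Type*} [Fintype P] [DecidableEq P]
    (s : Q → Prop) [DecidablePred s] (t : Q → P) {X : Matrix P Q ℂ}
    (hX : ∀ p q, X p q = if s q ∧ p = t q then 1 else 0) (N : Matrix P P ℂ) (x y : Q) :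
    (Xᴴ * N * X) x y = if s x ∧ s y then N (t x) (t y) else 0 := by
  by_cases hx : s x <;> by_cases hy : s y <;>
    simp [Matrix.mul_apply, hX, hx, hy, Finset.sum_ite_eq', ite_mul, apply_ite star]

/-- The Kraus operators of a measurement of the first factor of `X × C` that discards it. -/
noncomputable def discardKraus {X C A : Type*} [Fintype X] [DecidableEq X] [DecidableEq C]
    (e : A → X × C) (a : Fin (Fintype.card X)) : Matrix C A ℂ :=
  Matrix.of fun c z => if (e z).1 = (Fintype.equivFin X).symm a ∧ c = (e z).2 then 1 else 0

/-- Read through e, the operators are ⟨a| ⊗ 1, and Σ |a⟩⟨a| ⊗ 1 = 1. -/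
theorem sum_discardKraus {X C A : Type*} [Fintype X] [DecidableEq X] [Fintype C] [DecidableEq C]
    [DecidableEq A] (e : A ≃ X × C) :
    ∑ a, (discardKraus e a)ᴴ * discardKraus e a = 1 := by
  ext x y
  have h : ∀ a, ((discardKraus e a)ᴴ * discardKraus e a) x y =
      if (e x).1 = (Fintype.equivFin X).symm a ∧ (e y).1 = (Fintype.equivFin X).symm a then
        (1 : Matrix C C ℂ) (e x).2 (e y).2 else 0 := fun a => by
    have := conjTranspose_partialPerm_mul_mul (X := discardKraus e a) _ (fun z => (e z).2)
      (fun _ _ => rfl) 1 x y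
    rwa [Matrix.mul_one] at this
  rw [Matrix.sum_apply, Finset.sum_congr rfl fun a _ => h a,
    (Fintype.equivFin X).symm.sum_comp fun a =>
      if (e x).1 = a ∧ (e y).1 = a then (1 : Matrix C C ℂ) (e x).2 (e y).2 else 0]
  by_cases h1 : (e x).1 = (e y).1
  · by_cases h2 : (e x).2 = (e y).2
    · obtain rfl : x = y := e.injective (Prod.ext h1 h2)
      simp
    · have : x ≠ y := fun h => h2 (by rw [h])
      simp [h2, this]
  · have : x ≠ y := fun h => h1 (by rw [h])
    rw [Matrix.one_apply_ne this]
    refine Finset.sum_eq_zero fun a _ => if_neg fun h => h1 (h.1.trans h.2.symm)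

/-- Alice discards a part of her system and starts the protocol on the remaining part. -/
theorem IsLOCC.alice_discard {X : Type*} [Fintype X] [DecidableEq X]
    {N : Fin n → Matrix (C × B) (C × B) ℂ} (hN : IsLOCC N) (e : A ≃ X × C) :
    IsLOCC fun i => (Matrix.of fun x y : A × B =>
      if (e x.1).1 = (e y.1).1 then N i ((e x.1).2, x.2) ((e y.1).2, y.2) else 0) := by
  -- The result a is ignored: the same N follows every a, and summing over a leaves the identity on
  -- the discarded factor.
  convert IsLOCC.alice _ (discardKraus e) (sum_discardKraus e) (fun _ => N) (fun _ => hN)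
    using 2 with i
  ext x y
  have h : ∀ a, ((discardKraus e a ⊗ₖ (1 : Matrix B B ℂ))ᴴ * N i *
      (discardKraus e a ⊗ₖ (1 : Matrix B B ℂ)) : Matrix (A × B) (A × B) ℂ) x y =
      if (e x.1).1 = (Fintype.equivFin X).symm a ∧ (e y.1).1 = (Fintype.equivFin X).symm a then
        N i ((e x.1).2, x.2) ((e y.1).2, y.2) else 0 := fun a =>
    conjTranspose_partialPerm_mul_mul (fun z : A × B => (e z.1).1 = (Fintype.equivFin X).symm a)
      (fun z => ((e z.1).2, z.2)) (fun p q => by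
        simp only [Matrix.kroneckerMap_apply, discardKraus, Matrix.of_apply, Matrix.one_apply,
          Prod.ext_iff, mul_ite, mul_one, mul_zero, ← ite_and]
        congr 1
        exact propext ⟨fun h => ⟨h.2.1, h.2.2, h.1⟩, fun h => ⟨h.2.2, h.1, h.2.1⟩⟩) _ x y
  rw [Matrix.sum_apply, Finset.sum_congr rfl fun a _ => h a,
    (Fintype.equivFin X).symm.sum_comp fun a =>
      if (e x.1).1 = a ∧ (e y.1).1 = a then N i ((e x.1).2, x.2) ((e y.1).2, y.2) else 0]
  simp only [Matrix.of_apply, ite_and, Finset.sum_ite_eq, Finset.mem_univ, if_true]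
  exact if_congr eq_comm rfl rfl

/-- Bob discards a part of his system and starts the protocol on the remaining part. -/
theorem IsLOCC.bob_discard {X : Type*} [Fintype X] [DecidableEq X]
    {N : Fin n → Matrix (A × D) (A × D) ℂ} (hN : IsLOCC N) (e : B ≃ X × D) :
    IsLOCC fun i => (Matrix.of fun x y : A × B =>
      if (e x.2).1 = (e y.2).1 then N i (x.1, (e x.2).2) (y.1, (e y.2).2) else 0) := by
  convert IsLOCC.bob _ (discardKraus e) (sum_discardKraus e) (fun _ => N) (fun _ => hN)
    using 2 with i
  ext x y
  have h : ∀ a, (((1 : Matrix A A ℂ) ⊗ₖ discardKraus e a)ᴴ * N i *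
      ((1 : Matrix A A ℂ) ⊗ₖ discardKraus e a) : Matrix (A × B) (A × B) ℂ) x y =
      if (e x.2).1 = (Fintype.equivFin X).symm a ∧ (e y.2).1 = (Fintype.equivFin X).symm a then
        N i (x.1, (e x.2).2) (y.1, (e y.2).2) else 0 := fun a =>
    conjTranspose_partialPerm_mul_mul (fun z : A × B => (e z.2).1 = (Fintype.equivFin X).symm a)
      (fun z => (z.1, (e z.2).2)) (fun p q => by
        simp only [Matrix.kroneckerMap_apply, discardKraus, Matrix.of_apply, Matrix.one_apply,
          Prod.ext_iff, mul_ite, mul_one, mul_zero, ← ite_and]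
        congr 1
        exact propext ⟨fun h => ⟨h.1.1, h.2, h.1.2⟩, fun h => ⟨⟨h.1, h.2.2⟩, h.2.1⟩⟩) _ x y
  rw [Matrix.sum_apply, Finset.sum_congr rfl fun a _ => h a,
    (Fintype.equivFin X).symm.sum_comp fun a =>
      if (e x.2).1 = a ∧ (e y.2).1 = a then N i (x.1, (e x.2).2) (y.1, (e y.2).2) else 0]
  simp only [Matrix.of_apply, ite_and, Finset.sum_ite_eq, Finset.mem_univ, if_true]
  exact if_congr eq_comm rfl rfl

/-- Renaming the basis states of the two parties. -/
theorem IsLOCC.submatrix {M : Fin n → Matrix (A × B) (A × B) ℂ} (hM : IsLOCC M)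
    (e : A' ≃ A) (f : B' ≃ B) :
    IsLOCC fun i => (M i).submatrix (Prod.map e f) (Prod.map e f) := by
  -- A renaming is the discarding of a one-dimensional factor.
  convert (hM.alice_discard (e.trans (Equiv.uniqueProd A Unit).symm)).bob_discard
    (f.trans (Equiv.uniqueProd B Unit).symm) using 2 with i
  ext x y
  simp [Prod.map]

/-- A protocol carried out in the presence of idle additional systems. -/
theorem IsLOCC.one_tensor {N : Fin n → Matrix (C × D) (C × D) ℂ} (hN : IsLOCC N) :
    IsLOCC fun i => ((1 : Matrix (A × B) (A × B) ℂ) ⊗ₖ N i).submatrix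
      (Equiv.prodProdProdComm A C B D) (Equiv.prodProdProdComm A C B D) := by
  convert (hN.alice_discard (Equiv.refl (A × C))).bob_discard (Equiv.refl (B × D)) using 2 with i
  ext x y
  by_cases h1 : x.1.1 = y.1.1 <;> by_cases h2 : x.2.1 = y.2.1 <;>
    simp [h1, h2]

/-- The tensor product of operators on two pairs of systems, as an operator on the bipartite space
in which each party holds one system of each pair. -/
def pairTensor {A C : Type u} {B D : Type v} (M : Matrix (A × B) (A × B) ℂ)
    (N : Matrix (C × D) (C × D) ℂ) : Matrix ((A × C) × (B × D)) ((A × C) × (B × D)) ℂ :=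
  (M ⊗ₖ N).submatrix (Equiv.prodProdProdComm A C B D) (Equiv.prodProdProdComm A C B D)

omit [Fintype A] [Fintype B] [DecidableEq A] [DecidableEq A'] [DecidableEq B]
  [DecidableEq B'] in
-- A first move on the first pair, extended by the identity, passes through the tensor product with
-- N. Leaving X abstract lets the same identity serve the moves of Alice and of Bob.
theorem sum_pairTensor_conj {ι κ : Type*} (s : Finset ι) (t : Finset κ)
    (K : κ → Matrix (A' × B') (A × B) ℂ) (M : κ → ι → Matrix (A' × B') (A' × B') ℂ)
    (N : ι → Matrix (C × D) (C × D) ℂ)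
    (X : κ → Matrix ((A' × C) × (B' × D)) ((A × C) × (B × D)) ℂ)
    (hX : ∀ x, X x = (K x ⊗ₖ (1 : Matrix (C × D) (C × D) ℂ)).submatrix
      (Equiv.prodProdProdComm A' C B' D) (Equiv.prodProdProdComm A C B D)) :
    ∑ j ∈ s, pairTensor (∑ x ∈ t, (K x)ᴴ * M x j * K x) (N j) =
      ∑ x ∈ t, (X x)ᴴ * (∑ j ∈ s, pairTensor (M x j) (N j)) * X x := by
  have h : ∀ x j, pairTensor ((K x)ᴴ * M x j * K x) (N j) =
      (X x)ᴴ * pairTensor (M x j) (N j) * X x := fun x j => by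
    rw [hX, pairTensor, pairTensor, Matrix.conjTranspose_submatrix, Matrix.submatrix_mul_equiv,
      Matrix.submatrix_mul_equiv, Matrix.conjTranspose_kronecker, ← Matrix.mul_kronecker_mul,
      ← Matrix.mul_kronecker_mul, Matrix.conjTranspose_one, Matrix.one_mul, Matrix.mul_one]
  have hs : ∀ j, pairTensor (∑ x ∈ t, (K x)ᴴ * M x j * K x) (N j) =
      ∑ x ∈ t, pairTensor ((K x)ᴴ * M x j * K x) (N j) := fun j => by
    ext p q
    simp [pairTensor, Matrix.sum_apply, Finset.sum_mul]
  simp only [hs, h, Matrix.mul_sum, Matrix.sum_mul]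
  exact Finset.sum_comm

/-- Measuring `M` on a first pair of systems, and then, depending on the outcome `j`, the
measurement `N j` on a second pair. -/
theorem IsLOCC.tensor {m : ℕ} {M : Fin m → Matrix (A × B) (A × B) ℂ} (hM : IsLOCC M)
    {N : Fin m → Fin n → Matrix (C × D) (C × D) ℂ} (hN : ∀ j, IsLOCC (N j)) :
    IsLOCC fun i => ∑ j, pairTensor (M j) (N j i) := by
  induction hM with
  | @announce A B _ _ _ _ i₀ =>
    -- Only the outcome i₀ occurs, so the first pair stays idle while `N i₀` is run.
    convert (hN i₀).one_tensor (A := A) (B := B) using 2 with i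
    rw [Finset.sum_eq_single i₀]
    · simp [pairTensor]
    · intro j _ hj
      ext x y
      simp [pairTensor, hj]
    · simp
  | @alice A A' B _ _ _ _ _ _ k K hK M _ ih =>
    have h := IsLOCC.alice (A := A × C) (B := B × D) k (fun x => K x ⊗ₖ (1 : Matrix C C ℂ))
      (sum_kronecker_one_conj hK) _ ih
    convert h using 2 with i
    refine sum_pairTensor_conj _ _ _ M _ _ fun x => ?_
    rw [← Matrix.one_kronecker_one, ← Matrix.one_kronecker_one]
    ext p q
    simp only [Matrix.kroneckerMap_apply, Matrix.submatrix_apply,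
      Equiv.prodProdProdComm_apply]
    ring
  | @bob A B B' _ _ _ _ _ _ k K hK M _ ih =>
    have h := IsLOCC.bob (A := A × C) (B := B × D) k (fun x => K x ⊗ₖ (1 : Matrix D D ℂ))
      (sum_kronecker_one_conj hK) _ ih
    convert h using 2 with i
    refine sum_pairTensor_conj _ _ _ M _ _ fun x => ?_
    rw [← Matrix.one_kronecker_one, ← Matrix.one_kronecker_one]
    ext p q
    simp only [Matrix.kroneckerMap_apply, Matrix.submatrix_apply,
      Equiv.prodProdProdComm_apply]
    ring

/-- Independent LOCC measurements of `L` pairs of systems, followed by the announcement of the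
parity of the results. -/
theorem IsLOCC.exists_parity {M : Fin 2 → Matrix (A × B) (A × B) ℂ} (hM : IsLOCC M) (L : ℕ) :
    ∃ P : Fin 2 → Matrix ((Fin L → A) × (Fin L → B)) ((Fin L → A) × (Fin L → B)) ℂ,
      IsLOCC P ∧ P 0 - P 1 = bipartiteTensor fun _ => M 0 - M 1 := by
  induction L with
  | zero =>
    -- The empty string is even, and the empty tensor product is the identity.
    refine ⟨_, .announce 0, ?_⟩
    ext x y
    simp [bipartiteTensor, Subsingleton.elim x y]
  | succ L ih =>
    obtain ⟨P, hP, hPd⟩ := ih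
    -- Outcome j on the first copy shifts the parity labels of the others by j. The difference
    -- operator becomes Σ_j M_j ⊗ (P_j − P_{j+1}) = (M₀ − M₁) ⊗ (P₀ − P₁).
    have h := hM.tensor (N := fun j i => P (Equiv.addRight j i)) fun j => hP.perm _
    refine ⟨_, h.submatrix (Fin.consEquiv fun _ => A).symm (Fin.consEquiv fun _ => B).symm, ?_⟩
    ext x y
    have e := congrFun (congrFun hPd (Fin.tail x.1, Fin.tail x.2)) (Fin.tail y.1, Fin.tail y.2)
    have e1 : (1 : Fin 2) + 1 = 0 := rfl
    simp only [bipartiteTensor, Matrix.of_apply, Matrix.sub_apply] at e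
    simp only [bipartiteTensor, Matrix.of_apply, Fin.prod_univ_succ, Matrix.sub_apply,
      Matrix.submatrix_apply, Fin.sum_univ_two, Matrix.add_apply, pairTensor,
      Matrix.kroneckerMap_apply, Equiv.prodProdProdComm_apply, Prod.map, Fin.consEquiv,
      Equiv.coe_addRight, add_zero, zero_add, e1, Equiv.coe_fn_symm_mk]
    change _ = _ * ∏ l : Fin L, (M 0 (Fin.tail x.1 l, Fin.tail x.2 l)
      (Fin.tail y.1 l, Fin.tail y.2 l) - M 1 (Fin.tail x.1 l, Fin.tail x.2 l)
      (Fin.tail y.1 l, Fin.tail y.2 l))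
    rw [← e]
    ring

end LOCC

/-! ### Two-state ensembles -/

namespace BipartiteEnsemble

variable {A : Type u} {B : Type v} [Fintype A] [Fintype B]

/-- The difference of the weighted states of a two-state ensemble. -/
noncomputable def gap (E : BipartiteEnsemble A B 2) : Matrix (A × B) (A × B) ℂ :=
  E.η 0 • E.ρ 0 - E.η 1 • E.ρ 1

theorem gap_isHermitian (E : BipartiteEnsemble A B 2) : E.gap.IsHermitian :=
  (((E.ρ_posSemidef 0).smul (E.η_nonneg 0)).isHermitian).sub
    (((E.ρ_posSemidef 1).smul (E.η_nonneg 1)).isHermitian)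

theorem trace_smul_add_trace_smul (E : BipartiteEnsemble A B 2) :
    (E.η 0 • E.ρ 0).trace + (E.η 1 • E.ρ 1).trace = 1 := by
  have h := E.η_sum
  rw [Fin.sum_univ_two] at h
  rw [Matrix.trace_smul, Matrix.trace_smul, E.ρ_trace, E.ρ_trace, ← add_smul, h, one_smul]

theorem gap_multifold (E : BipartiteEnsemble A B 2) (L : ℕ) :
    (E.multifold L).gap = bipartiteTensor fun _ => E.gap := by
  have hs : ∀ i, (E.multifold L).η i • (E.multifold L).ρ i =
      ∑ c : Fin L → Fin 2 with modSum c = i, E.foldProb c • E.foldState c := fun i => by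
    change E.multiProb L i • E.multiState L i = _
    unfold multiState
    split_ifs with h
    · rw [h, zero_smul]
      -- A vanishing sum of nonnegative weights has only zero terms, so the default state plays no
      -- role.
      refine (Finset.sum_eq_zero fun c hc => ?_).symm
      have := (Finset.sum_eq_zero_iff_of_nonneg fun c _ => E.foldProb_nonneg c).1 h c hc
      rw [this, zero_smul]
    · rw [smul_smul, mul_inv_cancel₀ h, one_smul]
  -- The even indicator minus the odd one is a product of signs, one for each copy; this is what
  -- makes the gap factorize.
  have hsign : ∀ c : Fin L → Fin 2, (if modSum c = 0 then (1 : ℂ) else 0) -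
      (if modSum c = 1 then 1 else 0) = ∏ l, (-1) ^ (c l : ℕ) := fun c => by
    rw [Finset.prod_pow_eq_pow_sum, neg_one_pow_eq_pow_mod_two]
    rcases Nat.mod_two_eq_zero_or_one (∑ l, (c l : ℕ)) with h | h <;> simp [modSum, h]
  rw [gap, hs, hs]
  ext x y
  have hgap : ∀ l : Fin L, E.gap (x.1 l, x.2 l) (y.1 l, y.2 l) = ∑ j : Fin 2,
      (-1) ^ (j : ℕ) * (E.η j * E.ρ j (x.1 l, x.2 l) (y.1 l, y.2 l)) := fun l => by
    simp [gap, Fin.sum_univ_two, sub_eq_add_neg]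
  simp only [bipartiteTensor, Matrix.of_apply, hgap, Fintype.prod_sum, Finset.prod_mul_distrib,
    ← hsign, Matrix.sub_apply, Matrix.sum_apply, Finset.sum_filter, ← Finset.sum_sub_distrib]
  refine Finset.sum_congr rfl fun c _ => ?_
  have hc : (E.foldProb c • E.foldState c) x y = (∏ l, (E.η (c l) : ℂ)) *
      ∏ l, E.ρ (c l) (x.1 l, x.2 l) (y.1 l, y.2 l) := by
    simp [foldProb, foldState, bipartiteTensor]
  rw [← hc]
  simp only [Fin.val_zero, Fin.val_one, sub_mul, ite_mul, one_mul, zero_mul]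
  split_ifs <;> simp

theorem ptSuccess_eq [DecidableEq A] [DecidableEq B] (E : BipartiteEnsemble A B 2)
    {M : Fin 2 → Matrix (A × B) (A × B) ℂ} (hM : ∑ i, M i = 1) :
    E.ptSuccess M = 1 / 2 + 1 / 2 * (partialTranspose E.gap * (M 0 - M 1)).trace.re := by
  rw [Fin.sum_univ_two] at hM
  -- Partial transposition fixes the diagonal, so these traces agree definitionally with the
  -- original ones.
  have hT : (partialTranspose (E.η 0 • E.ρ 0)).trace + (partialTranspose (E.η 1 • E.ρ 1)).trace = 1 :=
    E.trace_smul_add_trace_smul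
  rw [gap, partialTranspose_sub, ← binary_success_eq hT hM, ptSuccess, Fin.sum_univ_two]
  simp [partialTranspose_smul]

theorem successProb_eq_ptSuccess (E : BipartiteEnsemble A B 2)
    (M : Fin 2 → Matrix (A × B) (A × B) ℂ) :
    E.successProb M = E.ptSuccess fun i => partialTranspose (M i) := by
  simp only [successProb, ptSuccess, partialTranspose_trace_mul]

variable [DecidableEq A] [DecidableEq B]

theorem successProb_eq (E : BipartiteEnsemble A B 2)
    {M : Fin 2 → Matrix (A × B) (A × B) ℂ} (hM : IsLOCC M) :
    E.successProb M = 1 / 2 + 1 / 2 * (E.gap * (M 0 - M 1)).trace.re := by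
  rw [successProb_eq_ptSuccess, E.ptSuccess_eq hM.isMeasurement_partialTranspose.2,
    ← partialTranspose_sub, partialTranspose_trace_mul]

theorem isGreatest_ptValues (E : BipartiteEnsemble A B 2) :
    IsGreatest E.ptValues (1 / 2 + 1 / 2 * traceAbs (partialTranspose E.gap)) := by
  have hg := isHermitian_partialTranspose E.gap_isHermitian
  constructor
  · obtain ⟨M, N, hM, hN, hMN, h⟩ := exists_trace_mul_sub_eq_traceAbs hg
    have hs : ∑ i, ![M, N] i = 1 := by simpa [Fin.sum_univ_two] using hMN
    refine ⟨![M, N], ⟨fun i => ?_, hs⟩, ?_⟩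
    · fin_cases i
      exacts [hM, hN]
    · rw [E.ptSuccess_eq hs]
      simpa using h
  · rintro _ ⟨M, hM, rfl⟩
    rw [E.ptSuccess_eq hM.2]
    have hs := hM.2
    rw [Fin.sum_univ_two] at hs
    linarith [trace_mul_sub_le_traceAbs hg (hM.1 0) (hM.1 1) hs]

theorem qG_eq (E : BipartiteEnsemble A B 2) :
    E.qG = 1 / 2 + 1 / 2 * traceAbs (partialTranspose E.gap) :=
  E.isGreatest_ptValues.csSup_eq

theorem qG_multifold (E : BipartiteEnsemble A B 2) (L : ℕ) :
    (E.multifold L).qG = 1 / 2 + 1 / 2 * (2 * E.qG - 1) ^ L := by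
  rw [qG_eq, qG_eq, gap_multifold, bipartiteTensor_partialTranspose, traceAbs_bipartiteTensor]
  congr 3
  ring

theorem qG_mem_upperBounds_loccValues (E : BipartiteEnsemble A B 2) :
    E.qG ∈ upperBounds E.loccValues := by
  rintro _ ⟨M, hM, rfl⟩
  rw [qG_eq, successProb_eq_ptSuccess]
  exact E.isGreatest_ptValues.2 ⟨_, hM.isMeasurement_partialTranspose, rfl⟩

theorem loccValues_nonempty (E : BipartiteEnsemble A B 2) : E.loccValues.Nonempty :=
  ⟨_, _, .announce 0, rfl⟩

/-- Using an LOCC measurement on each of the copies and announcing the parity of the results. -/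
theorem mem_loccValues_multifold (E : BipartiteEnsemble A B 2) (L : ℕ) {p : ℝ}
    (hp : p ∈ E.loccValues) : 1 / 2 + 1 / 2 * (2 * p - 1) ^ L ∈ (E.multifold L).loccValues := by
  obtain ⟨M, hM, rfl⟩ := hp
  obtain ⟨P, hP, hd⟩ := hM.exists_parity L
  refine ⟨P, hP, ?_⟩
  -- Partial transposition is an involution, so `M i` is the partial transpose of a positive
  -- operator.
  have hH : ∀ i, (M i).IsHermitian := fun i =>
    isHermitian_partialTranspose (hM.isMeasurement_partialTranspose.1 i).isHermitian
  have him : (E.gap * (M 0 - M 1)).trace = ((E.gap * (M 0 - M 1)).trace.re : ℂ) :=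
    Complex.ext rfl (by
      simpa using E.gap_isHermitian.trace_mul_im_eq_zero ((hH 0).sub (hH 1)))
  rw [successProb_eq _ hP, hd, gap_multifold, bipartiteTensor_mul, bipartiteTensor_trace,
    Finset.prod_const, Finset.card_univ, Fintype.card_fin, him, ← Complex.ofReal_pow,
    Complex.ofReal_re, E.successProb_eq hM]
  congr 3
  ring

/-- The supremum need not be attained, so LOCC values tending to q_G are taken and their images
under the continuous map p ↦ 1/2 + 1/2 (2p − 1)^L pass to the limit; monotonicity of that map is not
needed. -/
theorem pL_multifold (E : BipartiteEnsemble A B 2) (L : ℕ) (h : E.pL = E.qG) :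
    (E.multifold L).pL = (E.multifold L).qG := by
  -- Nonemptiness and the bound by q_G make `sSup` a true least upper bound.
  have hlub : IsLUB E.loccValues E.qG :=
    h ▸ isLUB_csSup E.loccValues_nonempty ⟨_, E.qG_mem_upperBounds_loccValues⟩
  obtain ⟨u, -, -, hu, hmem⟩ := hlub.exists_seq_monotone_tendsto E.loccValues_nonempty
  refine IsLUB.csSup_eq ⟨qG_mem_upperBounds_loccValues _, fun b hb => ?_⟩ (loccValues_nonempty _)
  rw [qG_multifold]
  exact le_of_tendsto' ((((hu.const_mul 2).sub_const 1).pow L).const_mul (1 / 2) |>.const_add (1 / 2))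
    fun k => hb (E.mem_loccValues_multifold L (hmem k))

end BipartiteEnsemble

theorem theorem3 {A : Type*} {B : Type*} [Fintype A] [Fintype B] [DecidableEq A] [DecidableEq B]
    (E : BipartiteEnsemble A B 2) (L : ℕ) (hL : 0 < L) :
    -- the maxima defining `q_G` exist
    IsGreatest E.ptValues E.qG ∧
    IsGreatest (E.multifold L).ptValues (E.multifold L).qG ∧
    -- the two formulas
    (E.multifold L).qG = 1 / 2 + 1 / 2 *
      traceAbs (E.η 0 • partialTranspose (E.ρ 0) - E.η 1 • partialTranspose (E.ρ 1)) ^ L ∧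
    (E.multifold L).qG = 1 / 2 + 1 / 2 * (2 * E.qG - 1) ^ L ∧
    -- equality of `p_L` and `q_G` is inherited, and so is its attainment by an LOCC measurement
    (E.pL = E.qG → (E.multifold L).pL = (E.multifold L).qG) ∧
    (IsGreatest E.loccValues E.qG →
      IsGreatest (E.multifold L).loccValues (E.multifold L).qG) := by
  refine ⟨E.qG_eq ▸ E.isGreatest_ptValues,
    (E.multifold L).qG_eq ▸ (E.multifold L).isGreatest_ptValues, ?_, E.qG_multifold L,
    E.pL_multifold L, fun h => ⟨?_, (E.multifold L).qG_mem_upperBounds_loccValues⟩⟩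
  · rw [E.qG_multifold, E.qG_eq, BipartiteEnsemble.gap, partialTranspose_sub,
      partialTranspose_smul, partialTranspose_smul]
    congr 3
    ring
  · rw [E.qG_multifold]
    exact E.mem_loccValues_multifold L h.1
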